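/- Let $\mathrm{pos}(t)=1$ if $t>0$ and $\mathrm{pos}(t)=0$ otherwise. For $f:\mathbb{R}^d\to\{0,1\}$ and a distribution $D$ on $\mathbb{R}^d$, the bag oracle $\mathrm{Ex}(f,D,q,k)$ returns a bag $(x^{(1)},\dots,x^{(q)})$ of independent vectors, where $x^{(1)},\dots,x^{(k)}$ are distributed as $D$ conditioned on $f=1$ and $x^{(k+1)},\dots,x^{(q)}$ as $D$ conditioned on $f=0$. **Theorem.** There are a randomized algorithm $A$ (one program for all inputs) and absolute constants $T, C>0$ such that the following holds for all integers $d\ge 1$, $q>2$, $1\le k\le q-1$ with $k\ne q/2$, and $m\ge 1$. 1. Given $m,q,k$ and access to a bag oracle on $\mathbb{R}^d$, $A$ always draws exactly $m$ bags $B_1,\dots,B_m$ and halts after at most $Tm$ steps, that is, in $O(m)$ time, where a step is an oracle call, the choice of a uniformly random index, the access to one vector of a bag, or one arithmetic operation, square root, comparison or jump on numbers or on vectors of $\mathbb{R}^d$. When an operation on vectors of $\mathbb{R}^d$ is counted as $d$ scalar operations, the total is at most $Tdm$. With $x_i$ the vector chosen uniformly at random from $B_i$ and $\hat\mu=\frac1m\sum_{i=1}^m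 x_i$, the output is $\hat r=\hat\mu/\|\hat\mu\|_2$ if $k>q/2$ and $\hat r=-\hat\mu/\|\hat\mu\|_2$ if $k<q/2$ (with $\hat r=0$ if $\hat\mu=0$). 2. Let $r_*\in\mathbb{R}^d$ with $\|r_*\|_2=1$, let $f(x)=\mathrm{pos}(r_*^{\mathsf T}x)$, and let the bags be drawn iid from $\mathrm{Ex}(f,N(\mathbf 0,\mathbf I),q,k)$. For all $\varepsilon,\delta>0$, if $$m\;\ge\; \frac{C}{(2k/q-1)^2}\cdot\frac{d}{\varepsilon^2}\,\log\frac d\delta ,$$ then with probability at least $1-\delta$ the hypothesis $h(x)=\mathrm{pos}(\hat r^{\mathsf T}x)$ satisfies $\Pr_{x\sim N(\mathbf 0,\mathbf I)}[f(x)\ne h(x)]\le\varepsilon$. In particular, for fixed $q$ and $k$, $m=O\big((d/\varepsilon^2)\log(d/\delta)\big)$ bags suffice. -/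

import Mathlib

open MeasureTheory ProbabilityTheory

noncomputable section

namespace LLP

/-! ### Linear threshold functions and the bag oracle -/

/-- Feature vectors: `ℝ^d` with the Euclidean inner product and norm. -/
abbrev Vec (d : ℕ) : Type := EuclideanSpace ℝ (Fin d)

/-- A bag of `q` feature vectors. -/
abbrev Bag (d q : ℕ) : Type := Fin q → Vec d

/-- The threshold function: label `1` (`true`) if `t > 0`, and label `0` (`false`) otherwise. -/
def pos (t : ℝ) : Bool := decide (0 < t)

/-- The homogeneous linear threshold function `x ↦ pos (rᵀ x)`. -/
def ltf {d : ℕ} (r : Vec d) (x : Vec d) : Bool := pos (inner ℝ r x)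

/-- The law of one bag of the oracle `Ex(f, D, q, k)`: the `q` vectors are independent, the first
`k` of them distributed as `D` conditioned on `f = 1`, the others as `D` conditioned on `f = 0`. -/
def bagOracle {d : ℕ} (f : Vec d → Bool) (D : Measure (Vec d)) (q k : ℕ) : Measure (Bag d q) :=
  Measure.pi fun i : Fin q => if i.val < k then D[|f ⁻¹' {true}] else D[|f ⁻¹' {false}]

/-- The instance error `Pr_{x ← D}[f(x) ≠ h(x)]`. -/
def instanceError {d : ℕ} (D : Measure (Vec d)) (f h : Vec d → Bool) : ENNReal :=
  D {x | f x ≠ h x}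

/-! ### The machine: a real RAM with vector registers

A program is a finite list of instructions that does not depend on the dimension, on the bag size
or on any other input. It computes on registers that hold natural numbers, reals, vectors and bags,
calls the bag oracle, and draws uniformly random members of `{0, …, q - 1}`. -/

/-- Instructions. Arguments name registers, except `c` (a constant) and `ℓ` (a program line). -/
inductive Instr : Type
  /-- `nat a := c` -/
  | natConst (a c : ℕ)
  /-- `nat a := nat b + nat c'` -/
  | natAdd (a b c' : ℕ)
  /-- `real x := nat a` -/
  | realOfNat (x a : ℕ)
  /-- `real x := real y + real z` -/
  | realAdd (x y z : ℕ)
  /-- `real x := real y - real z` -/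
  | realSub (x y z : ℕ)
  /-- `real x := real y * real z` -/
  | realMul (x y z : ℕ)
  /-- `real x := real y / real z` (with value `0` if `real z = 0`) -/
  | realDiv (x y z : ℕ)
  /-- `real x := √(real y)` (with value `0` if `real y < 0`) -/
  | realSqrt (x y : ℕ)
  /-- `vec u := vec v + vec w` -/
  | vecAdd (u v w : ℕ)
  /-- `vec u := real x • vec v` -/
  | vecSmul (u x v : ℕ)
  /-- `real x := (vec u)ᵀ (vec v)` -/
  | vecInner (x u v : ℕ)
  /-- `bag b := ` the next bag of the oracle -/
  | draw (b : ℕ)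
  /-- `nat a := ` a fresh uniformly random member of `{0, …, q - 1}` -/
  | rand (a : ℕ)
  /-- `vec u := ` the vector of `bag b` at position `nat a` (counted from `0`) -/
  | pick (u b a : ℕ)
  /-- go to line `ℓ` -/
  | jump (ℓ : ℕ)
  /-- go to line `ℓ` if `nat a < nat b` -/
  | jumpNatLt (a b ℓ : ℕ)
  /-- go to line `ℓ` if `real x < real y` -/
  | jumpRealLt (x y ℓ : ℕ)

/-- The number of scalar operations of an instruction in dimension `d`: an operation on whole
vectors counts `d`, every other instruction counts `1`. -/
def Instr.scalarCost (d : ℕ) : Instr → ℕ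
  | .vecAdd _ _ _ => d
  | .vecSmul _ _ _ => d
  | .vecInner _ _ _ => d
  | .pick _ _ _ => d
  | _ => 1

abbrev Program : Type := List Instr

/-- What a run reads from outside: the answers of the bag oracle and the random indices. -/
structure Tape (d q : ℕ) where
  bags : ℕ → Bag d q
  coins : ℕ → Fin q

/-- A configuration: the line to be executed next, the contents of the registers, and the numbers
of bags drawn, of random indices drawn and of scalar operations spent so far. -/
structure Config (d q : ℕ) where
  line : ℕ
  nat : ℕ → ℕ
  real : ℕ → ℝ
  vec : ℕ → Vec d
  bag : ℕ → Bag d q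
  bagsDrawn : ℕ
  coinsDrawn : ℕ
  scalarOps : ℕ

/-- The initial configuration: `m`, `q`, `k` are in the first three natural-number registers, and
all other registers are zero. -/
def Config.init (d q k m : ℕ) : Config d q where
  line := 0
  nat := fun a => if a = 0 then m else if a = 1 then q else if a = 2 then k else 0
  real := fun _ => 0
  vec := fun _ => 0
  bag := fun _ => 0
  bagsDrawn := 0
  coinsDrawn := 0
  scalarOps := 0

/-- The effect of an instruction, apart from the accounting of scalar operations. -/
def Instr.exec {d q : ℕ} (τ : Tape d q) (σ : Config d q) : Instr → Config d q
  | .natConst a c => { σ with line := σ.line + 1, nat := Function.update σ.nat a c }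
  | .natAdd a b c' =>
      { σ with line := σ.line + 1, nat := Function.update σ.nat a (σ.nat b + σ.nat c') }
  | .realOfNat x a =>
      { σ with line := σ.line + 1, real := Function.update σ.real x (σ.nat a : ℝ) }
  | .realAdd x y z =>
      { σ with line := σ.line + 1, real := Function.update σ.real x (σ.real y + σ.real z) }
  | .realSub x y z =>
      { σ with line := σ.line + 1, real := Function.update σ.real x (σ.real y - σ.real z) }
  | .realMul x y z =>
      { σ with line := σ.line + 1, real := Function.update σ.real x (σ.real y * σ.real z) }
  | .realDiv x y z =>
      { σ with line := σ.line + 1, real := Function.update σ.real x (σ.real y / σ.real z) }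
  | .realSqrt x y =>
      { σ with line := σ.line + 1, real := Function.update σ.real x (Real.sqrt (σ.real y)) }
  | .vecAdd u v w =>
      { σ with line := σ.line + 1, vec := Function.update σ.vec u (σ.vec v + σ.vec w) }
  | .vecSmul u x v =>
      { σ with line := σ.line + 1, vec := Function.update σ.vec u (σ.real x • σ.vec v) }
  | .vecInner x u v =>
      { σ with line := σ.line + 1,
               real := Function.update σ.real x (inner ℝ (σ.vec u) (σ.vec v)) }
  | .draw b =>
      { σ with line := σ.line + 1, bag := Function.update σ.bag b (τ.bags σ.bagsDrawn),
               bagsDrawn := σ.bagsDrawn + 1 }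
  | .rand a =>
      { σ with line := σ.line + 1, nat := Function.update σ.nat a (τ.coins σ.coinsDrawn).val,
               coinsDrawn := σ.coinsDrawn + 1 }
  | .pick u b a =>
      { σ with line := σ.line + 1,
               vec := Function.update σ.vec u
                 (if h : σ.nat a < q then σ.bag b ⟨σ.nat a, h⟩ else 0) }
  | .jump ℓ => { σ with line := ℓ }
  | .jumpNatLt a b ℓ =>
      { σ with line := if σ.nat a < σ.nat b then ℓ else σ.line + 1 }
  | .jumpRealLt x y ℓ =>
      { σ with line := if σ.real x < σ.real y then ℓ else σ.line + 1 }

/-- One step of a program. A configuration whose line is beyond the end of the program is halted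
and does not change any more. -/
def Program.step (p : Program) {d q : ℕ} (τ : Tape d q) (σ : Config d q) : Config d q :=
  match p[σ.line]? with
  | none => σ
  | some i => { i.exec τ σ with scalarOps := σ.scalarOps + i.scalarCost d }

/-- On inputs `m`, `q`, `k`, dimension `d` and tape `τ`, the program halts after at most `t` steps,
and `σ` is its final configuration. -/
def Program.HaltsWithin (p : Program) {d q : ℕ} (k m : ℕ) (τ : Tape d q) (t : ℕ)
    (σ : Config d q) : Prop :=
  (p.step τ)^[t] (Config.init d q k m) = σ ∧ p.length ≤ σ.line

/-- The output of a halted run: the first vector register. -/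
def Config.output {d q : ℕ} (σ : Config d q) : Vec d := σ.vec 0

/-! ### The mean of one random vector per bag -/

/-- The mean of the vectors picked from the first `m` bags, one from each. -/
def pickedMean {d q : ℕ} (τ : Tape d q) (m : ℕ) : Vec d :=
  (m : ℝ)⁻¹ • ∑ i ∈ Finset.range m, τ.bags i (τ.coins i)

/-- The normalized mean of the picked vectors, negated if `k < q / 2`. -/
def signedDirection {d q : ℕ} (k : ℕ) (τ : Tape d q) (m : ℕ) : Vec d :=
  if q < 2 * k then ‖pickedMean τ m‖⁻¹ • pickedMean τ m
  else -(‖pickedMean τ m‖⁻¹ • pickedMean τ m)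

/-- A random tape whose bags are iid from `Ex(f, D, q, k)` and whose indices are iid uniform on
`{0, …, q - 1}` and independent of the bags. -/
structure IsRandomTape {d q : ℕ} (f : Vec d → Bool) (D : Measure (Vec d)) (k : ℕ)
    {Ω : Type*} [MeasurableSpace Ω] (P : Measure Ω) (τ : Ω → Tape d q) : Prop where
  indep : iIndepFun (fun (n : ℕ) ω => ((τ ω).bags n, (τ ω).coins n)) P
  law : ∀ n : ℕ, HasLaw (fun ω => ((τ ω).bags n, (τ ω).coins n))
    ((bagOracle f D q k).prod (uniformOn (Set.univ : Set (Fin q)))) P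

end LLP

end

/-!
Write `γ` for the standard Gaussian on `ℝ^d`, `ζ = 2 k / q - 1`, and `y` for a vector picked at
random from a bag and multiplied by the sign of `ζ`. The law of the picked vector is the mixture
`pickedLaw` of the conditional laws of `γ` on the two sides of the hyperplane orthogonal to the
true normal vector `r`, with weights `k / q` and `1 - k / q` (`map_pick_eq`).

* In every direction orthogonal to `r` the picked vector is standard normal, because under `γ` this
  coordinate is independent of the label (`pickedLaw_map_inner_of_orthogonal`).
* In the direction `r`, the moment generating function of `y` at `-s` is
  `exp (s² / 2) - |ζ| (h s - h (-s))`, where `h` is the contribution of the positive half-line to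
  the moment generating function of `N(0, 1)`, and `h s - h (-s) ≥ s / 2` for `s ≥ 0`
  (`integral_pickedLaw_exp_le`).

The Chernoff bound gives `rᵀ ∑ y > m |ζ| / 4` except with probability `exp (-m ζ² / 64)`, and bounds
each of the `d - 1` orthogonal components of `∑ y` by `m ε |ζ| / (4 √d)` except with probability
`2 exp (-m ε² ζ² / (32 d))`. Outside these events the part of `∑ y` orthogonal to `r` is at most
`ε` times the part along `r`, and this ratio bounds the error of the hypothesis: with `a` the
component along `r`, and with `X = rᵀ x` and the contribution `W` of the orthogonal part independent
and normal, a disagreement forces `a |X| ≤ |W|`, an event of probability at most `E |W| / a`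
(`instanceError_le`). For `ε ≤ 1` the failure probability is at most
`(2 d - 1) exp (-m ε² ζ² / (64 d)) ≤ (2 d - 1) (δ / d)² ≤ δ` (`failure_le`).

The program is analysed by a loop invariant, on every tape (`meanProgram_correct`).
-/

namespace LLP

/-! ### The program -/

/-- The program of the algorithm. Line `0` stores the constant `1`, lines `1`–`6` form a loop that
adds up one random vector of each of `m` bags, lines `7`–`10` form the mean, lines `11`–`13` the
inverse of its norm, and lines `14`–`17` rescale, with a negated factor unless `q < 2 * k`. -/
def meanProgram : Program :=
  [.natConst 4 1,
   .draw 0, .rand 5, .pick 1 0 5, .vecAdd 0 0 1, .natAdd 3 3 4, .jumpNatLt 3 0 1,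
   .realOfNat 0 0, .realOfNat 1 4, .realDiv 0 1 0, .vecSmul 0 0 0,
   .vecInner 2 0 0, .realSqrt 2 2, .realDiv 2 1 2,
   .natAdd 6 2 2, .jumpNatLt 1 6 17, .realSub 2 3 2, .vecSmul 0 2 0]

variable {d q : ℕ}

/-- The state of `meanProgram` at the head of the loop, when `n` bags have been processed. The real
register `3` is never written: its initial value `0` serves to negate the factor in line `16`. -/
structure LoopInv (k m : ℕ) (τ : Tape d q) (n : ℕ) (σ : Config d q) : Prop where
  nat_m : σ.nat 0 = m
  nat_q : σ.nat 1 = q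
  nat_k : σ.nat 2 = k
  nat_count : σ.nat 3 = n
  nat_one : σ.nat 4 = 1
  real_zero : σ.real 3 = 0
  vec_sum : σ.vec 0 = ∑ i ∈ Finset.range n, τ.bags i (τ.coins i)
  bags : σ.bagsDrawn = n
  coins : σ.coinsDrawn = n
  ops : σ.scalarOps = 1 + n * (2 * d + 4)

lemma loop_body (k m : ℕ) (τ : Tape d q) (n : ℕ) (σ : Config d q) (h : LoopInv k m τ n σ)
    (hl : σ.line = 1) :
    LoopInv k m τ (n + 1) ((meanProgram.step τ)^[6] σ) ∧
      ((meanProgram.step τ)^[6] σ).line = if n + 1 < m then 1 else 7 := by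
  obtain ⟨h0, h1, h2, h3, h4, h5, h6, h7, h8, h9⟩ := h
  obtain ⟨l, nt, re, ve, bg, bd, cd, so⟩ := σ
  simp only at *
  subst hl
  refine ⟨⟨?_, ?_, ?_, ?_, ?_, ?_, ?_, ?_, ?_, ?_⟩, ?_⟩ <;>
  simp [Function.iterate_succ, Program.step, meanProgram, Instr.exec, Instr.scalarCost,
    Function.update, h0, h1, h2, h3, h4, h5, h6, h7, h8, h9, Finset.sum_range_succ]
  ring

lemma loop_run (k m : ℕ) (τ : Tape d q) (n : ℕ) (hn : n < m) :
    LoopInv k m τ (n + 1) ((meanProgram.step τ)^[6 * (n + 1) + 1] (Config.init d q k m)) ∧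
      ((meanProgram.step τ)^[6 * (n + 1) + 1] (Config.init d q k m)).line =
        if n + 1 < m then 1 else 7 := by
  induction n with
  | zero =>
    rw [Function.iterate_add_apply]
    apply loop_body
    · constructor <;>
        simp [Program.step, meanProgram, Instr.exec, Instr.scalarCost, Function.update, Config.init]
    · simp [Program.step, meanProgram, Instr.exec, Config.init]
  | succ n ih =>
    obtain ⟨h1, h2⟩ := ih (by omega)
    rw [if_pos hn] at h2
    rw [show 6 * (n + 1 + 1) + 1 = 6 + (6 * (n + 1) + 1) by ring, Function.iterate_add_apply]
    exact loop_body k m τ _ _ h1 h2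

lemma final_block (k m : ℕ) (τ : Tape d q) (σ : Config d q) (h : LoopInv k m τ m σ)
    (hl : σ.line = 7) :
    let σ' := (meanProgram.step τ)^[11] σ
    σ'.line = 18 ∧ σ'.bagsDrawn = m ∧ σ'.output = signedDirection k τ m ∧
      σ'.scalarOps ≤ 9 + 3 * d + m * (2 * d + 4) := by
  obtain ⟨h0, h1, h2, h3, h4, h5, h6, h7, h8, h9⟩ := h
  obtain ⟨l, nt, re, ve, bg, bd, cd, so⟩ := σ
  simp only at *
  subst hl
  by_cases hk : q < 2 * k
  · refine ⟨?_, ?_, ?_, ?_⟩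
    all_goals
      simp [Function.iterate_succ, Program.step, meanProgram, Instr.exec, Instr.scalarCost,
        Function.update, h0, h1, h2, h4, h6, h7, h9, ← two_mul, hk, Config.output,
        signedDirection, pickedMean]
    ring_nf
    omega
  · refine ⟨?_, ?_, ?_, ?_⟩
    all_goals
      simp [Function.iterate_succ, Program.step, meanProgram, Instr.exec, Instr.scalarCost,
        Function.update, h0, h1, h2, h4, h5, h6, h7, h9, ← two_mul, hk, Config.output,
        signedDirection, pickedMean]
    ring_nf
    omega

lemma step_of_halted (p : Program) (τ : Tape d q) (σ : Config d q) (h : p.length ≤ σ.line) :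
    p.step τ σ = σ := by
  simp [Program.step, List.getElem?_eq_none h]

/-- On every tape, the program halts in linear time and puts out the signed direction. -/
theorem meanProgram_correct (k m : ℕ) (hd : 1 ≤ d) (hm : 1 ≤ m) (τ : Tape d q) :
    ∃ σ : Config d q, meanProgram.HaltsWithin k m τ (30 * m) σ ∧ σ.scalarOps ≤ 30 * (d * m) ∧
      σ.bagsDrawn = m ∧ σ.output = signedDirection k τ m := by
  obtain ⟨h1, h2⟩ := loop_run k m τ (m - 1) (by omega)
  rw [Nat.sub_add_cancel hm] at h1 h2
  rw [if_neg (lt_irrefl _)] at h2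
  obtain ⟨g1, g2, g3, g4⟩ := final_block k m τ _ h1 h2
  refine ⟨_, ⟨?_, ?_⟩, ?_, g2, g3⟩
  -- the steps beyond the halt do not change the configuration
  · rw [show 30 * m = (24 * m - 12) + (11 + (6 * m + 1)) by omega,
      Function.iterate_add_apply _ _ (11 + _), Function.iterate_add_apply _ 11]
    exact Function.iterate_fixed (step_of_halted meanProgram _ _ g1.ge) _
  · exact g1.ge
  · refine g4.trans ?_
    nlinarith [Nat.mul_le_mul hd hm, Nat.mul_le_mul_left d hm, Nat.mul_le_mul_right m hd]

/-! ### The standard Gaussian on the line -/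

lemma gaussianReal_half_lines : gaussianReal 0 1 (Set.Ioi 0) = 2⁻¹ ∧
    gaussianReal 0 1 (Set.Iic 0) = 2⁻¹ := by
  have hna : NullSingletonClass (gaussianReal 0 1) := nullSingletonClass_gaussianReal one_ne_zero
  have hsymm : gaussianReal 0 1 (Set.Iic 0) = gaussianReal 0 1 (Set.Ioi 0) := by
    rw [← Iio_ae_eq_Iic.measure_eq]
    conv_lhs => rw [show gaussianReal 0 1 = (gaussianReal 0 1).map (fun x ↦ -x) by
      rw [gaussianReal_map_neg, neg_zero], Measure.map_apply (by fun_prop) measurableSet_Iio]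
    simp
  have hsum : gaussianReal 0 1 (Set.Iic 0) + gaussianReal 0 1 (Set.Ioi 0) = 1 := by
    rw [← Set.compl_Iic, measure_add_measure_compl measurableSet_Iic, measure_univ]
  rw [hsymm, ← two_mul] at hsum
  have := ENNReal.eq_inv_of_mul_eq_one_left (mul_comm (2 : ENNReal) _ ▸ hsum)
  exact ⟨this, hsymm.trans this⟩

/-- The standard normal density is at most `1 / √(2 π) ≤ 1 / 2`. -/
lemma gaussianReal_Icc_le (c : ℝ) :
    gaussianReal 0 1 (Set.Icc (-c) c) ≤ ENNReal.ofReal c := by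
  have hpdf : ∀ x, gaussianPDF 0 1 x ≤ ENNReal.ofReal (1 / 2) := by
    intro x
    rw [gaussianPDF_def]
    apply ENNReal.ofReal_le_ofReal
    rw [gaussianPDFReal_def]
    have h1 : (2 : ℝ) ≤ √(2 * Real.pi) := Real.le_sqrt_of_sq_le (by nlinarith [Real.pi_gt_three])
    have h2 : Real.exp (-(x - 0) ^ 2 / (2 * 1)) ≤ 1 :=
      Real.exp_le_one_iff.2 (by nlinarith [sq_nonneg x])
    have h3 : (√(2 * Real.pi))⁻¹ ≤ 1 / 2 := by
      rw [one_div]; exact inv_anti₀ (by norm_num) h1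
    simp only [NNReal.coe_one, mul_one] at h2 ⊢
    nlinarith [Real.exp_pos (-(x - 0) ^ 2 / 2)]
  rw [gaussianReal_of_var_ne_zero _ one_ne_zero, withDensity_apply _ measurableSet_Icc]
  calc _ ≤ ∫⁻ _ in Set.Icc (-c) c, ENNReal.ofReal (1 / 2) := lintegral_mono hpdf
    _ = ENNReal.ofReal c := by
      rw [lintegral_const, Measure.restrict_apply_univ, Real.volume_Icc,
        ← ENNReal.ofReal_mul (by norm_num)]
      congr 1; ring

/-- The exact value of the integral is `1 / √(2 π)`. -/
lemma integral_Ioi_id_gaussianReal : 1 / 4 ≤ ∫ x in Set.Ioi (0 : ℝ), x ∂gaussianReal 0 1 := by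
  have h := integral_rpow_mul_exp_neg_mul_rpow (p := 2) (q := 1) (b := 1 / 2) (by norm_num)
    (by norm_num) (by norm_num)
  have : ∫ x in Set.Ioi (0 : ℝ), x ∂gaussianReal 0 1
      = (√(2 * Real.pi))⁻¹ *
        ∫ x in Set.Ioi (0 : ℝ), x ^ (1 : ℝ) * Real.exp (-(1 / 2) * x ^ (2 : ℝ)) := by
    rw [gaussianReal_of_var_ne_zero _ one_ne_zero, restrict_withDensity measurableSet_Ioi,
      integral_withDensity_eq_integral_toReal_smul (measurable_gaussianPDF _ _)
        (by simp [gaussianPDF_lt_top]), ← integral_const_mul]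
    congr 1 with x
    rw [toReal_gaussianPDF, gaussianPDFReal_def]
    simp
    ring_nf
  rw [this, h]
  have h2 : √(2 * Real.pi) ≤ 4 := Real.sqrt_le_iff.2 ⟨by norm_num, by nlinarith [Real.pi_lt_four]⟩
  have h3 : (4 : ℝ)⁻¹ ≤ (√(2 * Real.pi))⁻¹ := inv_anti₀ (by positivity) h2
  norm_num [Real.rpow_neg_one] at h3 ⊢
  exact h3

/-- The contribution of the positive half-line to the moment generating function of `N(0, 1)`. -/
noncomputable def halfMGF (u : ℝ) : ℝ := ∫ x in Set.Ioi (0 : ℝ), Real.exp (u * x) ∂gaussianReal 0 1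

lemma integral_Iic_exp (u : ℝ) :
    ∫ x in Set.Iic (0 : ℝ), Real.exp (u * x) ∂gaussianReal 0 1 = halfMGF (-u) := by
  have hna : NullSingletonClass (gaussianReal 0 1) := nullSingletonClass_gaussianReal one_ne_zero
  have hmp : MeasurePreserving (fun x : ℝ ↦ -x) (gaussianReal 0 1) (gaussianReal 0 1) :=
    ⟨by fun_prop, by rw [gaussianReal_map_neg, neg_zero]⟩
  rw [halfMGF, ← setIntegral_congr_set Iio_ae_eq_Iic,
    ← hmp.setIntegral_preimage_emb (Homeomorph.neg ℝ).measurableEmbedding]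
  simp

lemma halfMGF_add (u : ℝ) : halfMGF u + halfMGF (-u) = Real.exp (u ^ 2 / 2) := by
  have h := congrFun (mgf_fun_id_gaussianReal (μ := 0) (v := 1)) u
  rw [← integral_Iic_exp, halfMGF, add_comm, ← Set.compl_Iic, integral_add_compl measurableSet_Iic
    (integrable_exp_mul_gaussianReal u)]
  simpa [mgf] using h

/-- For positive `u` the two half-lines differ by the integral of `2 sinh (u x) ≥ 2 u x`. -/
lemma le_halfMGF_sub (u : ℝ) (hu : 0 ≤ u) : u / 2 ≤ halfMGF u - halfMGF (-u) := by
  have hint : ∀ u : ℝ, Integrable (fun x ↦ Real.exp (u * x))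
      ((gaussianReal 0 1).restrict (Set.Ioi 0)) := fun u ↦
    (integrable_exp_mul_gaussianReal u).restrict
  rw [halfMGF, halfMGF, ← integral_sub (hint _) (hint _)]
  have hid : Integrable (fun x : ℝ ↦ x) ((gaussianReal 0 1).restrict (Set.Ioi 0)) :=
    (IsGaussian.integrable_id (μ := gaussianReal 0 1)).restrict
  calc u / 2 ≤ ∫ x in Set.Ioi (0 : ℝ), 2 * u * x ∂gaussianReal 0 1 := by
        rw [integral_const_mul]
        nlinarith [integral_Ioi_id_gaussianReal]
    _ ≤ _ := by
        refine setIntegral_mono_on (hid.const_mul _) ((hint _).sub (hint _)) measurableSet_Ioi ?_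
        intro x hx
        have := Real.self_le_sinh_iff.2 (mul_nonneg hu (le_of_lt hx))
        rw [Real.sinh_eq] at this
        simp only [neg_mul]
        linarith

/-! ### Linear functionals of a standard Gaussian vector -/

lemma stdGaussian_map_inner (w : Vec d) :
    (stdGaussian (Vec d)).map (fun x ↦ inner ℝ w x) = gaussianReal 0 (‖w‖₊ ^ 2) := by
  have h := IsGaussian.map_eq_gaussianReal (μ := stdGaussian (Vec d)) (innerSL ℝ w)
  rw [integral_strongDual_stdGaussian, variance_dual_stdGaussian, innerSL_apply_norm] at h
  convert! h using 2
  rw [Real.toNNReal_pow (norm_nonneg _), norm_toNNReal]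

lemma indepFun_inner_of_orthogonal (r w : Vec d) (h : inner ℝ r w = 0) :
    IndepFun (fun x ↦ inner ℝ r x) (fun x ↦ inner ℝ w x) (stdGaussian (Vec d)) := by
  apply HasGaussianLaw.indepFun_of_covariance_eq_zero
  · have : HasGaussianLaw (id : Vec d → Vec d) (stdGaussian (Vec d)) :=
      ⟨by rw [Measure.map_id]; infer_instance⟩
    exact this.map ((innerSL ℝ r).prod (innerSL ℝ w))
  · rw [← covarianceBilin_apply_eq_cov (IsGaussian.memLp_two_id), covarianceBilin_stdGaussian]
    exact h

lemma lintegral_abs_inner_le (w : Vec d) :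
    ∫⁻ x, ENNReal.ofReal |inner ℝ w x| ∂stdGaussian (Vec d) ≤ ENNReal.ofReal ‖w‖ := by
  rcases eq_or_ne w 0 with rfl | hw
  · simp
  have hpos : 0 < ‖w‖ := norm_pos_iff.2 hw
  have hmem : MemLp (fun x ↦ inner ℝ w x) 2 (stdGaussian (Vec d)) :=
    IsGaussian.memLp_dual (stdGaussian (Vec d)) (innerSL ℝ w) 2 (by simp)
  have hint := hmem.integrable_sq
  have hsq : ∫ x, (inner ℝ w x) ^ 2 ∂stdGaussian (Vec d) = ‖w‖ ^ 2 := by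
    have h := variance_dual_stdGaussian (innerSL ℝ w)
    rw [innerSL_apply_norm, variance_eq_integral (by fun_prop),
      integral_strongDual_stdGaussian] at h
    simpa using h
  rw [← ofReal_integral_eq_lintegral_ofReal (hmem.integrable (by norm_num)).abs
    (ae_of_all _ fun _ ↦ abs_nonneg _)]
  apply ENNReal.ofReal_le_ofReal
  -- the bound `2 |y| ≤ y² / ‖w‖ + ‖w‖` replaces the Cauchy–Schwarz inequality
  calc ∫ x, |inner ℝ w x| ∂stdGaussian (Vec d)
      ≤ ∫ x, ((2 * ‖w‖)⁻¹ * (inner ℝ w x) ^ 2 + ‖w‖ / 2) ∂stdGaussian (Vec d) := by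
        refine integral_mono (hmem.integrable (by norm_num)).abs
          ((hint.const_mul _).add (integrable_const _)) fun x ↦ ?_
        have h0 : ‖w‖ * ‖w‖⁻¹ = 1 := mul_inv_cancel₀ hpos.ne'
        have h1 := mul_nonneg (inv_nonneg.2 hpos.le) (sq_nonneg (|inner ℝ w x| - ‖w‖))
        have h2 : ‖w‖⁻¹ * (|inner ℝ w x| - ‖w‖) ^ 2
            = ‖w‖⁻¹ * (inner ℝ w x) ^ 2 - 2 * |inner ℝ w x| * (‖w‖ * ‖w‖⁻¹)
              + ‖w‖ * (‖w‖ * ‖w‖⁻¹) := by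
          rw [← sq_abs (inner ℝ w x)]; ring
        rw [h2, h0] at h1
        simp only [mul_inv]
        linarith
    _ = ‖w‖ := by
        rw [integral_add (hint.const_mul _) (integrable_const _), integral_const_mul, hsq]
        simp
        field_simp
        norm_num

/-- If `X = rᵀ x` and `W = wᵀ x` are independent, with `X` standard normal, then
`Pr[a |X| ≤ |W|] ≤ E |W| / a`, because the density of `X` is bounded. -/
lemma stdGaussian_slab_le (r w : Vec d) (hr : ‖r‖ = 1) (h : inner ℝ r w = 0) (a : ℝ)
    (ha : 0 < a) :
    stdGaussian (Vec d) {x | a * |inner ℝ r x| ≤ |inner ℝ w x|} ≤ ENNReal.ofReal (‖w‖ / a) := by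
  have hX : Measurable fun x : Vec d ↦ (inner ℝ r x : ℝ) := by fun_prop
  have hW : Measurable fun x : Vec d ↦ (inner ℝ w x : ℝ) := by fun_prop
  have hlaw := (indepFun_iff_map_prod_eq_prod_map_map hX.aemeasurable hW.aemeasurable).1
    (indepFun_inner_of_orthogonal r w h)
  have hr' : ‖r‖₊ = 1 := NNReal.eq hr
  have hXlaw := stdGaussian_map_inner r
  rw [hr', one_pow] at hXlaw
  rw [hXlaw] at hlaw
  have hS : MeasurableSet {p : ℝ × ℝ | a * |p.1| ≤ |p.2|} :=
    measurableSet_le (by fun_prop) (by fun_prop)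
  have : IsProbabilityMeasure ((stdGaussian (Vec d)).map fun x ↦ (inner ℝ w x : ℝ)) :=
    Measure.isProbabilityMeasure_map hW.aemeasurable
  calc stdGaussian (Vec d) {x | a * |inner ℝ r x| ≤ |inner ℝ w x|}
      = (stdGaussian (Vec d)).map (fun x ↦ ((inner ℝ r x : ℝ), (inner ℝ w x : ℝ)))
          {p : ℝ × ℝ | a * |p.1| ≤ |p.2|} := by
        rw [Measure.map_apply (hX.prodMk hW) hS]; rfl
    _ = ∫⁻ x, gaussianReal 0 1 {y | a * |y| ≤ |inner ℝ w x|} ∂stdGaussian (Vec d) := by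
        rw [hlaw, Measure.prod_apply_symm hS, lintegral_map (measurable_measure_prodMk_right hS) hW]
        rfl
    _ ≤ ∫⁻ x, ENNReal.ofReal a⁻¹ * ENNReal.ofReal |inner ℝ w x| ∂stdGaussian (Vec d) := by
        refine lintegral_mono fun x ↦ ?_
        rw [← ENNReal.ofReal_mul (by positivity)]
        refine (measure_mono fun y hy ↦ ?_).trans (gaussianReal_Icc_le _)
        rw [Set.mem_Icc, ← abs_le, ← div_eq_inv_mul, le_div_iff₀ ha, mul_comm]
        exact hy
    _ ≤ ENNReal.ofReal (‖w‖ / a) := by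
        rw [lintegral_const_mul _ (by fun_prop), div_eq_inv_mul,
          ENNReal.ofReal_mul (by positivity)]
        gcongr
        exact lintegral_abs_inner_le w

/-! ### The error of a hypothesis in terms of its direction -/

lemma ltf_smul (c : ℝ) (hc : 0 < c) (v : Vec d) : ltf (c • v) = ltf v := by
  funext x
  simp [ltf, pos, real_inner_smul_left, hc]

/-- The error of the hypothesis with normal vector `v` is at most the ratio of the parts of `v`
orthogonal and parallel to the true normal vector `r`. -/
lemma instanceError_le (r v : Vec d) (hr : ‖r‖ = 1) (hv : 0 < (inner ℝ r v : ℝ)) :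
    instanceError (stdGaussian (Vec d)) (ltf r) (ltf v) ≤
      ENNReal.ofReal (‖v - (inner ℝ r v : ℝ) • r‖ / inner ℝ r v) := by
  have horth : inner ℝ r (v - (inner ℝ r v : ℝ) • r) = 0 := by
    rw [inner_sub_right, real_inner_smul_right, real_inner_self_eq_norm_sq, hr]; ring
  refine (measure_mono fun x hx ↦ ?_).trans (stdGaussian_slab_le r _ hr horth _ hv)
  have hdec : (inner ℝ v x : ℝ)
      = inner ℝ r v * inner ℝ r x + inner ℝ (v - (inner ℝ r v : ℝ) • r) x := by
    rw [inner_sub_left, real_inner_smul_left]; ring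
  simp only [Set.mem_ofPred_eq, ltf, pos, ne_eq, decide_eq_decide, hdec] at hx ⊢
  set a : ℝ := inner ℝ r v
  set X : ℝ := inner ℝ r x
  set W : ℝ := inner ℝ (v - a • r) x
  rcases lt_or_ge 0 X with hX | hX
  · have : a * X + W ≤ 0 := by
      by_contra hcon
      exact hx ⟨fun _ ↦ not_le.1 hcon, fun _ ↦ hX⟩
    rw [abs_of_pos hX]
    linarith [neg_abs_le W]
  · have : 0 < a * X + W := by
      by_contra hcon
      exact hx ⟨fun h ↦ absurd h hX.not_gt, fun h ↦ absurd h hcon⟩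
    rw [abs_of_nonpos hX]
    linarith [le_abs_self W]

/-! ### The law of a vector picked at random from a bag -/

/-- The law of a uniformly random member of a bag: the mixture of the two class-conditional laws
in which the class `1` has weight `k / q`. -/
noncomputable def pickedLaw (f : Vec d → Bool) (D : Measure (Vec d)) (q k : ℕ) : Measure (Vec d) :=
  (k / q : ENNReal) • D[|f ⁻¹' {true}] + ((q - k : ℕ) / q : ENNReal) • D[|f ⁻¹' {false}]

lemma measurable_pick : Measurable fun p : Bag d q × Fin q ↦ p.1 p.2 :=
  measurable_from_prod_countable_left fun i ↦ measurable_pi_apply i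

lemma map_pick_eq (f : Vec d → Bool) (D : Measure (Vec d)) (k : ℕ) (hk : k ≤ q) (hq : 0 < q)
    [IsProbabilityMeasure D[|f ⁻¹' {true}]] [IsProbabilityMeasure D[|f ⁻¹' {false}]] :
    ((bagOracle f D q k).prod (uniformOn (Set.univ : Set (Fin q)))).map (fun p ↦ p.1 p.2)
      = pickedLaw f D q k := by
  have : NeZero q := ⟨hq.ne'⟩
  let μ : Fin q → Measure (Vec d) := fun i ↦
    if i.val < k then D[|f ⁻¹' {true}] else D[|f ⁻¹' {false}]
  have hμ : ∀ i, IsProbabilityMeasure (μ i) := fun i ↦ by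
    simp only [μ]; split_ifs <;> infer_instance
  have hbag : bagOracle f D q k = Measure.pi μ := rfl
  ext s hs
  rw [Measure.map_apply measurable_pick hs, hbag, Measure.prod_apply_symm (measurable_pick hs)]
  have h1 : ∀ i : Fin q,
      Measure.pi μ ((fun B ↦ (B, i)) ⁻¹' ((fun p : Bag d q × Fin q ↦ p.1 p.2) ⁻¹' s)) = μ i s :=
    fun i ↦ (measurePreserving_eval μ i).measure_preimage hs.nullMeasurableSet
  simp_rw [h1]
  have hsingle : ∀ i : Fin q, uniformOn (Set.univ : Set (Fin q)) {i} = (q : ENNReal)⁻¹ := fun i ↦ by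
    rw [uniformOn_univ, Measure.count_singleton, Fintype.card_fin, one_div]
  rw [lintegral_fintype]
  simp_rw [hsingle]
  have hsum : ∑ i : Fin q, μ i s * (q : ENNReal)⁻¹
      = ∑ i ∈ Finset.range q, (if i < k then D[|f ⁻¹' {true}] s else D[|f ⁻¹' {false}] s)
          * (q : ENNReal)⁻¹ := by
    rw [← Fin.sum_univ_eq_sum_range
      (fun i ↦ (if i < k then D[|f ⁻¹' {true}] s else D[|f ⁻¹' {false}] s) * (q : ENNReal)⁻¹)]
    refine Finset.sum_congr rfl fun i _ ↦ ?_
    simp only [μ]; split_ifs <;> rfl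
  rw [hsum, ← Finset.sum_range_add_sum_Ico _ hk,
    Finset.sum_congr rfl fun i hi ↦ by rw [if_pos (Finset.mem_range.1 hi)],
    Finset.sum_congr (s₁ := Finset.Ico k q) rfl fun i hi ↦ by
      rw [if_neg (Finset.mem_Ico.1 hi).1.not_gt]]
  simp only [Finset.sum_const, Finset.card_range, Nat.card_Ico, nsmul_eq_mul, pickedLaw,
    Measure.add_apply, Measure.smul_apply, smul_eq_mul, div_eq_mul_inv]
  ring

/-! ### Conditioning a Gaussian vector on the side of a hyperplane -/

lemma ltf_preimage (r : Vec d) :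
    ltf r ⁻¹' {true} = (fun x ↦ (inner ℝ r x : ℝ)) ⁻¹' Set.Ioi 0 ∧
    ltf r ⁻¹' {false} = (fun x ↦ (inner ℝ r x : ℝ)) ⁻¹' Set.Iic 0 := by
  constructor <;> ext x <;> simp [ltf, pos]

lemma stdGaussian_map_inner_of_norm_one (r : Vec d) (hr : ‖r‖ = 1) :
    (stdGaussian (Vec d)).map (fun x ↦ inner ℝ r x) = gaussianReal 0 1 := by
  rw [stdGaussian_map_inner, show ‖r‖₊ = 1 from NNReal.eq hr, one_pow]

lemma stdGaussian_ltf (r : Vec d) (hr : ‖r‖ = 1) (b : Bool) :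
    stdGaussian (Vec d) (ltf r ⁻¹' {b}) = 2⁻¹ := by
  have hm : Measurable fun x : Vec d ↦ (inner ℝ r x : ℝ) := by fun_prop
  cases b
  · rw [(ltf_preimage r).2, ← Measure.map_apply hm measurableSet_Iic,
      stdGaussian_map_inner_of_norm_one r hr, gaussianReal_half_lines.2]
  · rw [(ltf_preimage r).1, ← Measure.map_apply hm measurableSet_Ioi,
      stdGaussian_map_inner_of_norm_one r hr, gaussianReal_half_lines.1]

lemma measurable_ltf (r : Vec d) : Measurable (ltf r) := by
  refine measurable_to_bool ?_
  rw [(ltf_preimage r).1]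
  exact (by fun_prop : Measurable fun x : Vec d ↦ (inner ℝ r x : ℝ)) measurableSet_Ioi

lemma isProbabilityMeasure_cond_ltf (r : Vec d) (hr : ‖r‖ = 1) (b : Bool) :
    IsProbabilityMeasure (stdGaussian (Vec d))[|ltf r ⁻¹' {b}] :=
  cond_isProbabilityMeasure (by simp [stdGaussian_ltf r hr])

/-- The label does not affect the coordinate in a direction orthogonal to the normal vector. -/
lemma cond_map_inner_of_orthogonal (r e : Vec d) (hr : ‖r‖ = 1) (he : ‖e‖ = 1)
    (h : inner ℝ r e = 0) (b : Bool) :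
    ((stdGaussian (Vec d))[|ltf r ⁻¹' {b}]).map (fun x ↦ inner ℝ e x) = gaussianReal 0 1 := by
  have hm : Measurable fun x : Vec d ↦ (inner ℝ e x : ℝ) := by fun_prop
  have hA : ∃ s : Set ℝ, MeasurableSet s ∧ ltf r ⁻¹' {b} = (fun x ↦ (inner ℝ r x : ℝ)) ⁻¹' s := by
    cases b
    · exact ⟨_, measurableSet_Iic, (ltf_preimage r).2⟩
    · exact ⟨_, measurableSet_Ioi, (ltf_preimage r).1⟩
  obtain ⟨A, hAm, hA⟩ := hA
  ext s hs
  rw [Measure.map_apply hm hs, cond_apply (measurable_ltf r (measurableSet_singleton b)),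
    hA, (indepFun_inner_of_orthogonal r e h).measure_inter_preimage_eq_mul _ _ hAm hs, ← hA,
    stdGaussian_ltf r hr, ← mul_assoc, ENNReal.inv_mul_cancel (by simp) (by simp), one_mul,
    ← Measure.map_apply hm hs, stdGaussian_map_inner_of_norm_one e he]

/-- A picked vector is standard normal in every direction orthogonal to the true normal vector. -/
lemma pickedLaw_map_inner_of_orthogonal (r e : Vec d) (hr : ‖r‖ = 1) (he : ‖e‖ = 1)
    (h : inner ℝ r e = 0) (k : ℕ) (hk : k ≤ q) (hq : 0 < q) :
    (pickedLaw (ltf r) (stdGaussian (Vec d)) q k).map (fun x ↦ inner ℝ e x)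
      = gaussianReal 0 1 := by
  rw [pickedLaw, Measure.map_add _ _ (by fun_prop), Measure.map_smul, Measure.map_smul,
    cond_map_inner_of_orthogonal r e hr he h, cond_map_inner_of_orthogonal r e hr he h, ← add_smul,
    ← ENNReal.add_div, ← Nat.cast_add, Nat.add_sub_cancel' hk,
    ENNReal.div_self (by simpa using hq.ne') (by simp), one_smul]

lemma integral_cond_ltf_exp (r : Vec d) (hr : ‖r‖ = 1) (u : ℝ) (b : Bool) :
    ∫ x, Real.exp (u * inner ℝ r x) ∂(stdGaussian (Vec d))[|ltf r ⁻¹' {b}]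
      = 2 * halfMGF (if b then u else -u) := by
  have hm : Measurable fun x : Vec d ↦ (inner ℝ r x : ℝ) := by fun_prop
  have hlaw := stdGaussian_map_inner_of_norm_one r hr
  rw [ProbabilityTheory.cond, stdGaussian_ltf r hr, inv_inv, integral_smul_measure]
  simp only [ENNReal.toReal_ofNat, smul_eq_mul]
  congr 1
  have hset : ∀ s : Set ℝ, MeasurableSet s →
      ∫ x in (fun x ↦ (inner ℝ r x : ℝ)) ⁻¹' s, Real.exp (u * inner ℝ r x) ∂stdGaussian (Vec d)
        = ∫ x in s, Real.exp (u * x) ∂gaussianReal 0 1 := fun s hs ↦ by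
    rw [← hlaw, setIntegral_map hs (by fun_prop) hm.aemeasurable]
  cases b
  · rw [(ltf_preimage r).2, hset _ measurableSet_Iic, integral_Iic_exp]; rfl
  · rw [(ltf_preimage r).1, hset _ measurableSet_Ioi]; rfl

lemma integrable_cond_ltf_exp (r e : Vec d) (u : ℝ) (b : Bool) (c : ENNReal) (hc : c ≠ ⊤)
    (hb : stdGaussian (Vec d) (ltf r ⁻¹' {b}) ≠ 0) :
    Integrable (fun x ↦ Real.exp (u * inner ℝ e x))
      (c • (stdGaussian (Vec d))[|ltf r ⁻¹' {b}]) := by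
  have h : Integrable (fun x ↦ Real.exp (u * inner ℝ e x)) (stdGaussian (Vec d)) := by
    have h := integrable_exp_mul_gaussianReal (μ := 0) (v := ‖e‖₊ ^ 2) u
    rw [← stdGaussian_map_inner] at h
    exact h.comp_measurable (by fun_prop)
  refine (h.restrict.smul_measure ?_).smul_measure hc
  exact ENNReal.inv_ne_top.2 hb

/-- With `ζ = 2 k / q - 1`, the moment generating function of a picked vector in the direction of
the true normal vector is that of a normal variable, shifted by `ζ` times an odd function that is
at least `u / 2` for positive `u`. -/
lemma integral_pickedLaw_exp (r : Vec d) (hr : ‖r‖ = 1) (k : ℕ) (hk : k ≤ q) (hq : 0 < q) (u : ℝ) :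
    ∫ x, Real.exp (u * inner ℝ r x) ∂pickedLaw (ltf r) (stdGaussian (Vec d)) q k
      = Real.exp (u ^ 2 / 2) + (2 * (k : ℝ) / q - 1) * (halfMGF u - halfMGF (-u)) := by
  have hq' : (q : ENNReal) ≠ 0 := by simpa using hq.ne'
  have hb : ∀ b, stdGaussian (Vec d) (ltf r ⁻¹' {b}) ≠ 0 := fun b ↦ by
    simp [stdGaussian_ltf r hr]
  rw [pickedLaw, integral_add_measure
    (integrable_cond_ltf_exp r r u _ _ (ENNReal.div_ne_top (by simp) hq') (hb _))
    (integrable_cond_ltf_exp r r u _ _ (ENNReal.div_ne_top (by simp) hq') (hb _)),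
    integral_smul_measure, integral_smul_measure, integral_cond_ltf_exp r hr,
    integral_cond_ltf_exp r hr, ← halfMGF_add]
  have : (q : ℝ) ≠ 0 := by exact_mod_cast hq.ne'
  simp only [ENNReal.toReal_div, ENNReal.toReal_natCast, Nat.cast_sub hk, smul_eq_mul, if_true,
    Bool.false_eq_true, if_false]
  field_simp
  ring

/-- The signed moment generating function is small at points of the order of `ζ = 2 k / q - 1`. -/
lemma integral_pickedLaw_exp_le (r : Vec d) (hr : ‖r‖ = 1) (k : ℕ) (hk : k ≤ q) (hq : 0 < q)
    (σ s : ℝ) (hσ : σ = 1 ∨ σ = -1) (hζ : σ * (2 * (k : ℝ) / q - 1) = |2 * (k : ℝ) / q - 1|)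
    (hs : 0 ≤ s) (hs1 : s ≤ 1) :
    ∫ x, Real.exp (-(σ * s) * inner ℝ r x) ∂pickedLaw (ltf r) (stdGaussian (Vec d)) q k
      ≤ Real.exp (s ^ 2 - |2 * (k : ℝ) / q - 1| * s / 2) := by
  rw [integral_pickedLaw_exp r hr k hk hq]
  have h1 : Real.exp (s ^ 2 / 2) ≤ 1 + s ^ 2 := by
    have := Real.abs_exp_sub_one_le (x := s ^ 2 / 2)
      (by rw [abs_of_nonneg (by positivity)]; nlinarith)
    rw [abs_of_nonneg (by positivity : (0 : ℝ) ≤ s ^ 2 / 2)] at this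
    linarith [(abs_le.1 this).2]
  have h2 := le_halfMGF_sub s hs
  have h3 := mul_le_mul_of_nonneg_left h2 (abs_nonneg (2 * (k : ℝ) / q - 1))
  have h4 := Real.add_one_le_exp (s ^ 2 - |2 * (k : ℝ) / q - 1| * s / 2)
  rw [← hζ] at h3 h4 ⊢
  rcases hσ with rfl | rfl
  · simp only [one_mul, neg_neg, neg_sq] at *
    linarith
  · simp only [neg_mul, one_mul, neg_neg] at *
    linarith

/-! ### Large deviations of a sum of independent copies -/

/-- Chernoff's bound, with the sign of the argument of the moment generating function absorbed in
the threshold. -/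
lemma measureReal_le_sum_le {Ω : Type*} [MeasurableSpace Ω] {P : Measure Ω}
    [IsProbabilityMeasure P] {X : ℕ → Ω → ℝ} (hind : iIndepFun X P)
    (hX : ∀ n, AEMeasurable (X n) P) (u b t : ℝ) (m : ℕ)
    (hint : ∀ n, Integrable (fun ω ↦ Real.exp (u * X n ω)) P)
    (hmgf : ∀ n, mgf (X n) P u ≤ Real.exp b) :
    P.real {ω | m * t ≤ u * ∑ n ∈ Finset.range m, X n ω} ≤ Real.exp (m * (b - t)) := by
  have hsum : Integrable (fun ω ↦ Real.exp (u * (∑ n ∈ Finset.range m, X n) ω)) P := by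
    have := hind.isProbabilityMeasure.ne_zero
    rw [← mgf_pos_iff, hind.mgf_sum₀ hX]
    exact Finset.prod_pos fun n _ ↦ mgf_pos (hint n)
  have h := measure_ge_le_exp_mul_mgf (X := fun ω ↦ u * (∑ n ∈ Finset.range m, X n) ω) (μ := P)
    (t := 1) (m * t) zero_le_one (by simpa using hsum)
  have hm : mgf (fun ω ↦ u * (∑ n ∈ Finset.range m, X n) ω) P 1 ≤ Real.exp (m * b) := by
    have : mgf (fun ω ↦ u * (∑ n ∈ Finset.range m, X n) ω) P 1
        = mgf (∑ n ∈ Finset.range m, X n) P u := by simp [mgf]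
    rw [this, hind.mgf_sum₀ hX, Real.exp_nat_mul]
    calc _ ≤ ∏ _n ∈ Finset.range m, Real.exp b :=
          Finset.prod_le_prod (fun _ _ ↦ mgf_nonneg) fun n _ ↦ hmgf n
      _ = _ := by simp
  calc _ ≤ Real.exp (-1 * (m * t)) * mgf (fun ω ↦ u * (∑ n ∈ Finset.range m, X n) ω) P 1 := by
        simpa using h
    _ ≤ Real.exp (-1 * (m * t)) * Real.exp (m * b) := by gcongr
    _ = _ := by rw [← Real.exp_add]; congr 1; ring

/-! ### From deviations in an orthonormal basis to the error of the hypothesis -/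

/-- The sign of `2 * k / q - 1`, with which the mean of the picked vectors is multiplied. -/
noncomputable def majoritySign (q k : ℕ) : ℝ := if q < 2 * k then 1 else -1

lemma majoritySign_eq (q k : ℕ) : majoritySign q k = 1 ∨ majoritySign q k = -1 := by
  unfold majoritySign; split_ifs <;> simp

lemma majoritySign_mul (q k : ℕ) (hq : 0 < q) :
    majoritySign q k * (2 * (k : ℝ) / q - 1) = |2 * (k : ℝ) / q - 1| := by
  have hq' : (0 : ℝ) < q := by exact_mod_cast hq
  unfold majoritySign
  split_ifs with h
  · have : (q : ℝ) < 2 * k := by exact_mod_cast h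
    rw [one_mul, abs_of_pos]
    rwa [sub_pos, one_lt_div hq']
  · have : 2 * (k : ℝ) ≤ q := by exact_mod_cast not_lt.1 h
    rw [neg_one_mul, abs_of_nonpos]
    rwa [sub_nonpos, div_le_one hq']

lemma ltf_signedDirection (k m : ℕ) (hm : 1 ≤ m) (τ : Tape d q)
    (hS : ∑ i ∈ Finset.range m, τ.bags i (τ.coins i) ≠ 0) :
    ltf (signedDirection k τ m)
      = ltf (majoritySign q k • ∑ i ∈ Finset.range m, τ.bags i (τ.coins i)) := by
  have hm' : (0 : ℝ) < m := by exact_mod_cast hm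
  have hM : pickedMean τ m ≠ 0 := smul_ne_zero (inv_ne_zero hm'.ne') hS
  have : signedDirection k τ m = (‖pickedMean τ m‖⁻¹ * (m : ℝ)⁻¹) •
      (majoritySign q k • ∑ i ∈ Finset.range m, τ.bags i (τ.coins i)) := by
    rw [smul_comm, mul_smul, ← pickedMean]
    unfold signedDirection majoritySign
    split_ifs <;> simp
  rw [this, ltf_smul _ (mul_pos (inv_pos.2 (norm_pos_iff.2 hM)) (inv_pos.2 hm'))]

/-- If `v` has a component larger than `A` along `r`, and components of size at most `B` in an
orthonormal basis of the orthogonal complement, then its error is at most `√d B / A`. -/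
lemma instanceError_le_of_components {ι : Type*} [Fintype ι] (r v : Vec d) (hr : ‖r‖ = 1)
    (e : OrthonormalBasis ι ℝ (ℝ ∙ r)ᗮ) (A B ε : ℝ) (hA : 0 < A)
    (hε : 0 ≤ ε) (hι : Fintype.card ι ≤ d) (hB : d * B ^ 2 ≤ (ε * A) ^ 2)
    (hrv : A < inner ℝ r v) (hev : ∀ j, |inner ℝ (e j : Vec d) v| ≤ B) :
    instanceError (stdGaussian (Vec d)) (ltf r) (ltf v) ≤ ENNReal.ofReal ε := by
  have hpos : (0 : ℝ) < inner ℝ r v := hA.trans hrv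
  refine (instanceError_le r v hr hpos).trans (ENNReal.ofReal_le_ofReal ?_)
  rw [div_le_iff₀ hpos]
  have hmem : v - (inner ℝ r v : ℝ) • r ∈ (ℝ ∙ r)ᗮ := by
    rw [Submodule.mem_orthogonal_singleton_iff_inner_right, inner_sub_right,
      real_inner_smul_right, real_inner_self_eq_norm_sq, hr]
    ring
  have hcoord : ∀ j, (inner ℝ (e j) (⟨_, hmem⟩ : (ℝ ∙ r)ᗮ) : ℝ) = inner ℝ (e j : Vec d) v := by
    intro j
    have horth := Submodule.mem_orthogonal_singleton_iff_inner_left.1 (e j).2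
    rw [Submodule.coe_inner, inner_sub_right, real_inner_smul_right, horth]
    ring
  have hnorm : ‖v - (inner ℝ r v : ℝ) • r‖ ^ 2 ≤ (ε * A) ^ 2 := by
    calc ‖v - (inner ℝ r v : ℝ) • r‖ ^ 2 = ∑ j, (inner ℝ (e j : Vec d) v : ℝ) ^ 2 := by
          have h := e.sum_sq_inner_right ⟨_, hmem⟩
          simp only [hcoord] at h
          exact h.symm
      _ ≤ ∑ _j : ι, B ^ 2 := Finset.sum_le_sum fun j _ ↦ sq_le_sq.2 ((hev j).trans (le_abs_self B))
      _ = Fintype.card ι * B ^ 2 := by simp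
      _ ≤ d * B ^ 2 := by gcongr
      _ ≤ _ := hB
  calc _ ≤ ε * A := le_of_sq_le_sq hnorm (by positivity)
    _ ≤ ε * inner ℝ r v := by gcongr

/-! ### The probability of a large error -/

section Sample

variable {Ω : Type*} [MeasurableSpace Ω] {P : Measure Ω}
  {τ : Ω → Tape d q} {r : Vec d} {k : ℕ}

lemma IsRandomTape.iIndepFun_pick {f : Vec d → Bool} {D : Measure (Vec d)}
    (hτ : IsRandomTape f D k P τ) :
    iIndepFun (fun n ω ↦ (τ ω).bags n ((τ ω).coins n)) P :=
  hτ.indep.comp (fun _ p ↦ p.1 p.2) fun _ ↦ measurable_pick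

lemma IsRandomTape.hasLaw_pick (hr : ‖r‖ = 1) (hk : k ≤ q) (hq : 0 < q)
    (hτ : IsRandomTape (ltf r) (stdGaussian (Vec d)) k P τ) (n : ℕ) :
    HasLaw (fun ω ↦ (τ ω).bags n ((τ ω).coins n)) (pickedLaw (ltf r) (stdGaussian (Vec d)) q k)
      P := by
  have := isProbabilityMeasure_cond_ltf r hr
  exact HasLaw.comp ⟨measurable_pick.aemeasurable, map_pick_eq _ _ k hk hq⟩ (hτ.law n)

variable [IsProbabilityMeasure P]

/-- Large deviations of a linear functional of the sum of the picked vectors. -/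
lemma IsRandomTape.measureReal_inner_sum_le (hr : ‖r‖ = 1) (hk : k ≤ q) (hq : 0 < q)
    (hτ : IsRandomTape (ltf r) (stdGaussian (Vec d)) k P τ) (m : ℕ) (e : Vec d) (u b t : ℝ)
    (hmgf : ∫ x, Real.exp (u * inner ℝ e x) ∂pickedLaw (ltf r) (stdGaussian (Vec d)) q k
      ≤ Real.exp b) :
    P.real {ω | m * t ≤ u * inner ℝ e (∑ n ∈ Finset.range m, (τ ω).bags n ((τ ω).coins n))}
      ≤ Real.exp (m * (b - t)) := by
  have hlaw := hτ.hasLaw_pick hr hk hq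
  have hq' : (q : ENNReal) ≠ 0 := by simpa using hq.ne'
  have hb : ∀ b, stdGaussian (Vec d) (ltf r ⁻¹' {b}) ≠ 0 := fun b ↦ by
    simp [stdGaussian_ltf r hr]
  have hint : Integrable (fun x ↦ Real.exp (u * inner ℝ e x))
      (pickedLaw (ltf r) (stdGaussian (Vec d)) q k) :=
    (integrable_cond_ltf_exp r e u _ _ (ENNReal.div_ne_top (by simp) hq') (hb _)).add_measure
      (integrable_cond_ltf_exp r e u _ _ (ENNReal.div_ne_top (by simp) hq') (hb _))
  have hind := hτ.iIndepFun_pick.comp (fun _ x ↦ (inner ℝ e x : ℝ)) fun _ ↦ by fun_prop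
  simp_rw [inner_sum]
  refine measureReal_le_sum_le hind (fun n ↦ ?_) u b t m (fun n ↦ ?_) fun n ↦ ?_
  · exact (by fun_prop : Measurable fun x : Vec d ↦ (inner ℝ e x : ℝ)).comp_aemeasurable
      (hlaw n).aemeasurable
  · have h := (hlaw n).map_eq
    rw [← h] at hint
    exact hint.comp_aemeasurable (hlaw n).aemeasurable
  · exact ((hlaw n).integral_comp hint.aestronglyMeasurable).trans_le hmgf

lemma IsRandomTape.measureReal_orthogonal_le (hr : ‖r‖ = 1) (hk : k ≤ q) (hq : 0 < q)
    (hτ : IsRandomTape (ltf r) (stdGaussian (Vec d)) k P τ) (m : ℕ) (e : Vec d)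
    (he : ‖e‖ = 1) (hre : inner ℝ r e = 0) (t : ℝ) (ht : 0 < t) :
    P.real {ω | m * t < |inner ℝ e (∑ n ∈ Finset.range m, (τ ω).bags n ((τ ω).coins n))|}
      ≤ 2 * Real.exp (-(m * (t ^ 2 / 2))) := by
  have hside : ∀ u : ℝ, u ^ 2 = t ^ 2 → P.real {ω | m * t ^ 2 ≤
      u * inner ℝ e (∑ n ∈ Finset.range m, (τ ω).bags n ((τ ω).coins n))}
      ≤ Real.exp (-(m * (t ^ 2 / 2))) := by
    intro u hu
    refine (hτ.measureReal_inner_sum_le hr hk hq m e u (u ^ 2 / 2) (t ^ 2) ?_).trans_eq ?_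
    · have h := mgf_gaussianReal (pickedLaw_map_inner_of_orthogonal r e hr he hre k hk hq) u
      refine (h.trans ?_).le
      simp
    · rw [hu]; ring_nf
  calc _ ≤ P.real ({ω | m * t ^ 2 ≤
          t * inner ℝ e (∑ n ∈ Finset.range m, (τ ω).bags n ((τ ω).coins n))} ∪ {ω | m * t ^ 2 ≤
          -t * inner ℝ e (∑ n ∈ Finset.range m, (τ ω).bags n ((τ ω).coins n))}) := by
        refine measureReal_mono fun ω hω ↦ ?_
        rcases lt_abs.1 (Set.mem_ofPred.1 hω) with h | h
        · left
          have := mul_lt_mul_of_pos_left h ht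
          simp only [Set.mem_ofPred_eq]; nlinarith
        · right
          have := mul_lt_mul_of_pos_left h ht
          simp only [Set.mem_ofPred_eq]; nlinarith
    _ ≤ _ := (measureReal_union_le _ _).trans
        (by linarith [hside t rfl, hside (-t) (neg_sq t)])

lemma IsRandomTape.measureReal_parallel_le (hr : ‖r‖ = 1) (hk : k ≤ q) (hq : 0 < q)
    (hτ : IsRandomTape (ltf r) (stdGaussian (Vec d)) k P τ) (m : ℕ)
    (hζ : |2 * (k : ℝ) / q - 1| ≤ 1) (hζ0 : 0 < |2 * (k : ℝ) / q - 1|) :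
    P.real {ω | inner ℝ r (majoritySign q k •
        ∑ n ∈ Finset.range m, (τ ω).bags n ((τ ω).coins n)) ≤ m * (|2 * (k : ℝ) / q - 1| / 4)}
      ≤ Real.exp (-(m * ((2 * (k : ℝ) / q - 1) ^ 2 / 64))) := by
  have hsgn := majoritySign_mul q k hq
  rw [← sq_abs (2 * (k : ℝ) / q - 1)]
  set z := |2 * (k : ℝ) / q - 1| with hz
  -- `s = z / 8` minimizes the exponent `s² - z s / 2 + z s / 4`
  refine le_trans (measureReal_mono fun ω hω ↦ ?_) ((hτ.measureReal_inner_sum_le hr hk hq m r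
    (-(majoritySign q k * (z / 8))) _ (-(z / 8 * (z / 4)))
    (integral_pickedLaw_exp_le r hr k hk hq _ (z / 8) (majoritySign_eq q k) hsgn
      (by positivity) (by linarith))).trans_eq ?_)
  · simp only [Set.mem_ofPred_eq, real_inner_smul_right] at hω ⊢
    have := mul_le_mul_of_nonneg_left hω (by positivity : 0 ≤ z / 8)
    linarith
  · rw [← hz]; ring_nf

/-- The union bound over the direction `r` and both signs of the `d - 1` orthogonal directions. -/
lemma IsRandomTape.exists_bad_event (hr : ‖r‖ = 1) (hd : 1 ≤ d) (hk1 : k ≤ q) (hq : 0 < q)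
    (hkq : 2 * k ≠ q) (hτ : IsRandomTape (ltf r) (stdGaussian (Vec d)) k P τ) (m : ℕ) (hm : 1 ≤ m)
    (ε : ℝ) (hε : 0 < ε) (hε1 : ε ≤ 1) :
    ∃ bad : Set Ω, P.real bad ≤ (2 * d - 1) *
        Real.exp (-(m * (ε ^ 2 * (2 * (k : ℝ) / q - 1) ^ 2 / (64 * d)))) ∧
      ∀ ω ∉ bad, instanceError (stdGaussian (Vec d)) (ltf r) (ltf (signedDirection k (τ ω) m))
        ≤ ENNReal.ofReal ε := by
  have hd' : (1 : ℝ) ≤ d := by exact_mod_cast hd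
  have hm' : (0 : ℝ) < m := by exact_mod_cast hm
  have hq' : (0 : ℝ) < q := by exact_mod_cast hq
  have hζ : |2 * (k : ℝ) / q - 1| ≤ 1 := by
    have h1 : (k : ℝ) / q ≤ 1 := div_le_one_of_le₀ (by exact_mod_cast hk1) hq'.le
    have h0 : 0 ≤ (k : ℝ) / q := by positivity
    rw [mul_div_assoc, abs_le]
    constructor <;> linarith
  have hζ0 : 0 < |2 * (k : ℝ) / q - 1| := by
    rw [abs_pos, sub_ne_zero, ne_eq, div_eq_one_iff_eq hq'.ne']
    exact_mod_cast hkq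
  have hpar := hτ.measureReal_parallel_le hr hk1 hq m hζ hζ0
  rw [← sq_abs (2 * (k : ℝ) / q - 1)] at hpar ⊢
  set z := |2 * (k : ℝ) / q - 1| with hz
  let e := stdOrthonormalBasis ℝ (ℝ ∙ r)ᗮ
  have hr0 : r ≠ 0 := norm_ne_zero_iff.1 (by rw [hr]; exact one_ne_zero)
  have hfin : Module.finrank ℝ (ℝ ∙ r)ᗮ = d - 1 := by
    have h := (ℝ ∙ r).finrank_add_finrank_orthogonal
    rw [finrank_span_singleton hr0, finrank_euclideanSpace_fin] at h
    omega
  let S : Ω → Vec d := fun ω ↦ ∑ n ∈ Finset.range m, (τ ω).bags n ((τ ω).coins n)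
  -- chosen so that `d` orthogonal components of size `m t` have total norm `ε (m z / 4)`
  let t : ℝ := ε * z / (4 * √d)
  have ht : 0 < t := by positivity
  have ht2 : d * t ^ 2 = (ε * (z / 4)) ^ 2 := by
    simp only [t, div_pow, mul_pow, Real.sq_sqrt (zero_le_one.trans hd')]
    field_simp
  let bad0 : Set Ω := {ω | inner ℝ r (majoritySign q k • S ω) ≤ m * (z / 4)}
  let badj : Fin (Module.finrank ℝ (ℝ ∙ r)ᗮ) → Set Ω := fun j ↦
    {ω | m * t < |inner ℝ (e j : Vec d) (S ω)|}
  refine ⟨bad0 ∪ ⋃ j, badj j, ?_, fun ω hω ↦ ?_⟩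
  · set x := m * (ε ^ 2 * z ^ 2 / (64 * d)) with hx
    have h0 : P.real bad0 ≤ Real.exp (-x) := by
      refine hpar.trans (Real.exp_le_exp.2 (neg_le_neg (mul_le_mul_of_nonneg_left ?_ hm'.le)))
      have h1 : ε ^ 2 ≤ d := (pow_le_one₀ hε.le hε1).trans hd'
      rw [div_le_div_iff₀ (by positivity) (by norm_num)]
      nlinarith [mul_le_mul_of_nonneg_right h1 (sq_nonneg z)]
    have hj : ∀ j, P.real (badj j) ≤ 2 * Real.exp (-x) := by
      intro j
      have he : ‖(e j : Vec d)‖ = 1 := e.orthonormal.1 j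
      have hre : inner ℝ r (e j : Vec d) = 0 :=
        Submodule.mem_orthogonal_singleton_iff_inner_right.1 (e j).2
      refine (hτ.measureReal_orthogonal_le hr hk1 hq m _ he hre t ht).trans ?_
      refine mul_le_mul_of_nonneg_left (Real.exp_le_exp.2 (neg_le_neg
        (mul_le_mul_of_nonneg_left ?_ hm'.le))) zero_le_two
      have : t ^ 2 = (ε * (z / 4)) ^ 2 / d := by rw [← ht2]; field_simp
      rw [this, div_div, div_le_div_iff₀ (by positivity) (by positivity)]
      have : 0 ≤ ε ^ 2 * z ^ 2 * d := by positivity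
      nlinarith
    calc _ ≤ P.real bad0 + ∑ j, P.real (badj j) :=
          (measureReal_union_le _ _).trans (by gcongr; exact measureReal_iUnion_fintype_le _)
      _ ≤ Real.exp (-x) + ∑ _j : Fin (Module.finrank ℝ (ℝ ∙ r)ᗮ), 2 * Real.exp (-x) := by
          gcongr with j; exact hj j
      _ = _ := by
          rw [Finset.sum_const, Finset.card_univ, Fintype.card_fin, hfin, nsmul_eq_mul,
            Nat.cast_sub hd]
          push_cast; ring
  · simp only [Set.mem_union, Set.mem_iUnion, not_or, not_exists] at hω
    have h0 : m * (z / 4) < inner ℝ r (majoritySign q k • S ω) := not_le.1 hω.1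
    have hA : 0 < m * (z / 4) := by positivity
    have hS : S ω ≠ 0 := fun h ↦ by
      rw [h, smul_zero, inner_zero_right] at h0
      linarith
    rw [ltf_signedDirection k m hm (τ ω) hS]
    refine instanceError_le_of_components r _ hr e (m * (z / 4)) (m * t) ε hA hε.le
      (by rw [Fintype.card_fin, hfin]; omega) ?_ h0 fun j ↦ ?_
    · rw [mul_pow, mul_left_comm, ht2]; apply le_of_eq; ring
    · have h : |inner ℝ (e j : Vec d) (S ω)| ≤ m * t := not_lt.1 (hω.2 j)
      rw [real_inner_smul_right, abs_mul]
      rcases majoritySign_eq q k with hs | hs <;> simpa [hs] using h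

end Sample

/-- The sample size makes the failure probability at most `δ`; the point is that
`(2 d - 1) (δ / d) ^ 2 ≤ δ`, which has no spare constant when `d = 1`. -/
lemma failure_le (d : ℕ) (hd : 1 ≤ d) (m ε δ ζ : ℝ) (hε : 0 < ε) (hδ : 0 < δ) (hδ1 : δ ≤ 1)
    (hζ : ζ ≠ 0) (hm : 128 / ζ ^ 2 * ((d / ε ^ 2) * Real.log (d / δ)) ≤ m) :
    (2 * d - 1) * Real.exp (-(m * (ε ^ 2 * ζ ^ 2 / (64 * d)))) ≤ δ := by
  have hd' : (1 : ℝ) ≤ d := by exact_mod_cast hd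
  have hd0 : (0 : ℝ) < d := by linarith
  have hx : 2 * Real.log (d / δ) ≤ m * (ε ^ 2 * ζ ^ 2 / (64 * d)) := by
    refine le_of_eq_of_le ?_
      (mul_le_mul_of_nonneg_right hm (by positivity : 0 ≤ ε ^ 2 * ζ ^ 2 / (64 * d)))
    field_simp
    ring
  have hexp : Real.exp (-(2 * Real.log (d / δ))) = (δ / d) ^ 2 := by
    rw [two_mul, neg_add, Real.exp_add, Real.exp_neg, Real.exp_log (by positivity), inv_div, sq]
  calc _ ≤ (2 * d - 1) * (δ / d) ^ 2 := by
        rw [← hexp]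
        exact mul_le_mul_of_nonneg_left (Real.exp_le_exp.2 (neg_le_neg hx)) (by linarith)
    _ ≤ δ := by
        rw [div_pow, ← mul_div_assoc, div_le_iff₀ (by positivity)]
        have h1 : δ ^ 2 ≤ δ := by nlinarith
        have h2 : 2 * (d : ℝ) - 1 ≤ d ^ 2 := by nlinarith [sq_nonneg ((d : ℝ) - 1)]
        calc (2 * (d : ℝ) - 1) * δ ^ 2 ≤ (2 * d - 1) * δ := by gcongr; linarith
          _ ≤ d ^ 2 * δ := by gcongr
          _ = _ := mul_comm _ _

end LLP

theorem theorem1 :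
    ∃ (A : LLP.Program) (T : ℕ) (C : ℝ), 0 < C ∧
      ∀ d q k m : ℕ, 1 ≤ d → 2 < q → 1 ≤ k → k ≤ q - 1 → 2 * k ≠ q → 1 ≤ m →
        (∀ τ : LLP.Tape d q, ∃ σ : LLP.Config d q,
            A.HaltsWithin k m τ (T * m) σ ∧
            σ.scalarOps ≤ T * (d * m) ∧
            σ.bagsDrawn = m ∧
            σ.output = LLP.signedDirection k τ m) ∧
        (∀ ε δ : ℝ, 0 < ε → 0 < δ →
          C / (2 * (k : ℝ) / q - 1) ^ 2 * ((d / ε ^ 2) * Real.log (d / δ)) ≤ m →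
          ∀ r : LLP.Vec d, ‖r‖ = 1 →
          ∀ {Ω : Type*} [MeasurableSpace Ω] (P : MeasureTheory.Measure Ω)
            [MeasureTheory.IsProbabilityMeasure P] (τ : Ω → LLP.Tape d q),
            LLP.IsRandomTape (LLP.ltf r) (ProbabilityTheory.stdGaussian (LLP.Vec d)) k P τ →
            ENNReal.ofReal (1 - δ) ≤
              P {ω | ∃ σ : LLP.Config d q,
                A.HaltsWithin k m (τ ω) (T * m) σ ∧
                LLP.instanceError (ProbabilityTheory.stdGaussian (LLP.Vec d))
                  (LLP.ltf r) (LLP.ltf σ.output) ≤ ENNReal.ofReal ε}) := by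
  refine ⟨LLP.meanProgram, 30, 128, by norm_num, fun d q k m hd hq hk hkq hne hm ↦
    ⟨fun τ ↦ LLP.meanProgram_correct k m hd hm τ, ?_⟩⟩
  intro ε δ hε hδ hmC r hr Ω _ P _ τ hτ
  rcases le_or_gt 1 δ with hδ1 | hδ1
  · simp [ENNReal.ofReal_of_nonpos (sub_nonpos.2 hδ1)]
  -- an error is a probability, so accuracies above `1` hold on the whole space
  obtain ⟨bad, hbad, hgood⟩ : ∃ bad : Set Ω, P.real bad ≤ δ ∧ ∀ ω ∉ bad,
      LLP.instanceError (stdGaussian (LLP.Vec d)) (LLP.ltf r)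
        (LLP.ltf (LLP.signedDirection k (τ ω) m)) ≤ ENNReal.ofReal ε := by
    rcases le_or_gt ε 1 with hε1 | hε1
    · obtain ⟨bad, hbad, hgood⟩ :=
        hτ.exists_bad_event hr hd (by omega) (by omega) hne m hm ε hε hε1
      have hζ : 2 * (k : ℝ) / q - 1 ≠ 0 := by
        have hq' : (q : ℝ) ≠ 0 := by exact_mod_cast (by omega : q ≠ 0)
        rw [sub_ne_zero, ne_eq, div_eq_one_iff_eq hq']
        exact_mod_cast hne
      exact ⟨bad, hbad.trans (LLP.failure_le d hd m ε δ _ hε hδ hδ1.le hζ hmC), hgood⟩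
    · refine ⟨∅, by simpa using hδ.le, fun ω _ ↦ prob_le_one.trans ?_⟩
      simpa using hε1.le
  have hsub : badᶜ ⊆ {ω | ∃ σ : LLP.Config d q, LLP.meanProgram.HaltsWithin k m (τ ω) (30 * m) σ ∧
      LLP.instanceError (stdGaussian (LLP.Vec d)) (LLP.ltf r) (LLP.ltf σ.output)
        ≤ ENNReal.ofReal ε} := fun ω hω ↦ by
    obtain ⟨σ, hσ, -, -, hout⟩ := LLP.meanProgram_correct k m hd hm (τ ω)
    exact ⟨σ, hσ, hout ▸ hgood ω hω⟩
  refine le_trans ?_ (measure_mono hsub)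
  have hbad' : P bad ≤ ENNReal.ofReal δ :=
    (ENNReal.le_ofReal_iff_toReal_le (measure_ne_top _ _) hδ.le).2 hbad
  rw [ENNReal.ofReal_sub _ hδ.le, ENNReal.ofReal_one, tsub_le_iff_right]
  -- subadditivity needs no measurability of the set of bad outcomes
  calc 1 = P (badᶜ ∪ bad) := by rw [Set.compl_union_self, measure_univ]
    _ ≤ P badᶜ + P bad := measure_union_le _ _
    _ ≤ P badᶜ + ENNReal.ofReal δ := by gcongr
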